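/- For a subset $F$ of a topological space $T$ and an ordinal $\alpha$, let $S_\alpha(F)$ be defined by $S_0(F)=F$; $S_{\alpha+1}(F)$ is the set of all limits of sequences in $S_\alpha(F)$; and $S_\alpha(F)=\bigcup_{\beta<\alpha}S_\beta(F)$ if $\alpha$ is a limit ordinal. The space $T$ is sequential if every sequentially closed subset of $T$ is closed, and it has sequential order $\alpha$ if $\alpha$ is the least ordinal such that $S_\alpha(F)=\overline{F}$ for every $F\subseteq T$. A space is scattered if each of its nonempty subsets has a relatively isolated point. For a scattered compact space $K$, let $K^{(\alpha)}$ denote its Cantor–Bendixson derivatives ($K^{(0)}=K$, $K^{(\alpha+1)}$ is the set of non-isolated points of $K^{(\alpha)}$, and $K^{(\alpha)}=\bigcap_{\beta<\alpha}K^{(\beta)}$ for limit $\alpha$), and let $ht(K)$ be the least ordinal $\gamma$ such that $K^{(\gamma)}$ is discrete. Theorem. Let $K$ be an infinite scattered compact Hausdorff space with $ht(K)<\omega_1$, and let $C(K)$ be the Banach space of continuous scalar-valued (real or complex) functions on $K$ with the supremum norm. Then the closed unit ball of the dual $C(K)^*$, with the weak* topology, is a sequential space. Moreover its sequential order is $\leq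 ht(K)$ if $ht(K)<\omega$, and $\leq ht(K)+1$ if $ht(K)\geq\omega$. -/

import Mathlib

open Set Filter Topology CantorBendixson
open scoped Ordinal

universe u v w

/-- A topological space is scattered if every nonempty subset has a (relatively) isolated point. -/
def IsScattered (K : Type u) [TopologicalSpace K] : Prop :=
  ∀ A : Set K, A.Nonempty → ∃ x ∈ A, ∃ U : Set K, IsOpen U ∧ U ∩ A = {x}

/-- The `α`-th Cantor-Bendixson derivative `K^(α)` of a topological space `K`. -/
def cbDerivative (K : Type u) [TopologicalSpace K] (α : Ordinal.{u}) : Set K :=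
  iteratedDerivedSet (Set.univ : Set K) α

/-- The height of `K`: the least ordinal `γ` such that `K^(γ)` is discrete
(such `γ` exists for scattered `K`, see `discreteTopology_cbDerivative_height`). -/
noncomputable def height (K : Type u) [TopologicalSpace K] : Ordinal.{u} :=
  sInf {γ : Ordinal.{u} | DiscreteTopology (cbDerivative K γ)}

theorem IsScattered.exists_cbDerivative_eq_empty {K : Type u} [TopologicalSpace K]
    (hK : IsScattered K) : ∃ γ : Ordinal.{u}, cbDerivative K γ = ∅ := by
  obtain ⟨γ, hγ⟩ := iteratedDerivedSet_mem_fixedPoints (Set.univ : Set K)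
  refine ⟨γ, ?_⟩
  by_contra hne
  obtain ⟨x, hx, U, hU, hUA⟩ := hK _ (Set.nonempty_iff_ne_empty.mpr hne)
  have hp : Preperfect (iteratedDerivedSet (Set.univ : Set K) γ) :=
    preperfect_iff_eq_relDerivedSet.mpr (Function.mem_fixedPoints_iff.mp hγ).symm
  have hxU : x ∈ U := by
    have : x ∈ U ∩ cbDerivative K γ := by rw [hUA]; exact Set.mem_singleton x
    exact this.1
  obtain ⟨y, hy, hyx⟩ := preperfect_iff_nhds.mp hp x hx U (hU.mem_nhds hxU)
  have hy' : y ∈ U ∩ cbDerivative K γ := hy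
  rw [hUA] at hy'
  exact hyx hy'

theorem IsScattered.discreteTopology_cbDerivative_height {K : Type u} [TopologicalSpace K]
    (hK : IsScattered K) : DiscreteTopology (cbDerivative K (height K)) := by
  obtain ⟨γ, hγ⟩ := hK.exists_cbDerivative_eq_empty
  have hmem : γ ∈ {γ : Ordinal.{u} | DiscreteTopology (cbDerivative K γ)} := by
    change DiscreteTopology (cbDerivative K γ)
    rw [hγ]
    infer_instance
  exact csInf_mem (s := {γ : Ordinal.{u} | DiscreteTopology (cbDerivative K γ)}) ⟨γ, hmem⟩

/-- The `α`-th sequential closure `S_α(F)` of a subset `F` of a topological space: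
`S_0(F) = F`, `S_{α+1}(F)` is the set of limits of sequences in `S_α(F)`, and
`S_α(F) = ⋃ β < α, S_β(F)` for limit `α`. -/
noncomputable def iterSeqClosure {T : Type v} [TopologicalSpace T] (F : Set T)
    (α : Ordinal.{w}) : Set T :=
  Ordinal.limitRecOn (motive := fun _ => Set T) α F (fun _ S => seqClosure S)
    (fun α _ S => ⋃ (β : Ordinal.{w}) (h : β < α), S β h)

theorem iterSeqClosure_zero {T : Type v} [TopologicalSpace T] (F : Set T) :
    iterSeqClosure F (0 : Ordinal.{w}) = F := by
  simp [iterSeqClosure]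

theorem iterSeqClosure_add_one {T : Type v} [TopologicalSpace T] (F : Set T)
    (α : Ordinal.{w}) : iterSeqClosure F (α + 1) = seqClosure (iterSeqClosure F α) := by
  simp [iterSeqClosure]

theorem iterSeqClosure_limit {T : Type v} [TopologicalSpace T] (F : Set T)
    {α : Ordinal.{w}} (hα : Order.IsSuccLimit α) :
    iterSeqClosure F α = ⋃ (β : Ordinal.{w}) (_ : β < α), iterSeqClosure F β := by
  simp only [iterSeqClosure]
  rw [Ordinal.limitRecOn_limit _ _ _ _ hα]

/-- `T` has sequential order `α`: `S_α(F) = closure F` for every `F ⊆ T`, and `α` is the least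
ordinal with this property. -/
def HasSequentialOrder (T : Type v) [TopologicalSpace T] (α : Ordinal.{w}) : Prop :=
  (∀ F : Set T, iterSeqClosure F α = closure F) ∧
    ∀ β < α, ∃ F : Set T, iterSeqClosure F β ≠ closure F

/-- `T` has sequential order at most `α`. -/
def HasSequentialOrderLE (T : Type v) [TopologicalSpace T] (α : Ordinal.{w}) : Prop :=
  ∃ β ≤ α, HasSequentialOrder T β

/-- The closed unit ball of the dual of a normed space `X`, as a subset of `X*` with its weak*
topology. -/
def dualBall (𝕜 : Type v) [RCLike 𝕜] (X : Type w) [NormedAddCommGroup X] [NormedSpace 𝕜 X] :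
    Set (WeakDual 𝕜 X) :=
  WeakDual.toStrongDual ⁻¹' Metric.closedBall (0 : StrongDual 𝕜 X) 1

/-- `X` has weak*-sequential dual ball: `B_{X*}` is a sequential space in the weak* topology. -/
def HasWeakStarSequentialDualBall (𝕜 : Type v) [RCLike 𝕜] (X : Type w) [NormedAddCommGroup X]
    [NormedSpace 𝕜 X] : Prop :=
  SequentialSpace (dualBall 𝕜 X)

/-!
The proof works directly with functionals on `C(K)` and never represents them by measures. Write
`T` for the dual ball and `Y_α` for the space of functions vanishing on `K^(α)`, so that `Y_0 = 0`,
and `Y_γ` has finite codimension for `γ = height K`. The point is that each step from `Y_α` to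
`Y_(α+1)` only adds a copy of `c₀(Γ)`, where `Γ = K^(α) \ K^(α+1)` consists of isolated points of
`K^(α)`: with a peak function `e x` for each `x ∈ Γ`, the functions `e x` and `Y_α` span a dense
subspace of `Y_(α+1)` (`IsPeakFamily.mem_of_isClosed`), and two functionals in `T` that agree on
`Y_α` have values on the `e x` that differ by at most `2` in `ℓ¹(Γ)`
(`IsPeakFamily.exists_sum_norm_sub_le`). At a limit ordinal `α`, the union of the `Y_β`, `β < α`, is
dense in `Y_α` (`mem_of_mem_vanishingOnDerivative_limit`).

Sequential compactness of `T` comes first. By induction on `α < ω₁`, every countably generated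
filter on `T` has a countably generated refinement along which the functionals converge on `Y_α`
(`exists_refinement_tendsto_on_vanishingOnDerivative`). The successor step rests on the fact that a
family eventually bounded in `ℓ¹(Γ)` on every finite set of coordinates has a refinement converging
at all coordinates (`exists_refinement_forall_tendsto`), although `Γ` may be uncountable.

Now let `μ` be in the closure of `F ⊆ T`. By induction on `α`, the set `S_o(F)`, where `o` is `α` or
`α + 1` according as `α` is finite or infinite, has a point agreeing with `μ` on `Y_α`
(`reachesClosureOn_vanishingOnDerivative`). Applying this to `F ∩ W` for closed neighbourhoods `W`
of `μ` shows that `μ` is even in the closure `cl G` of the set `G` of such points. For the successor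
step, the Fréchet-Urysohn argument for the dual ball of `c₀(Γ)` yields a sequence in `G` that
converges to `μ` on `Y_(α+1)` (`exists_seq_tendsto_of_mem_closure`); for the limit step, take points
agreeing with `μ` on `Y_(β n)` for a sequence `β n` tending to `α`. By sequential compactness, a
refinement of the tail filter of the sequence converges in `T`; its limit belongs to the sequential
closure and agrees with `μ` on the larger space. In both cases the
sequence can be made to converge to `μ` at finitely many further functions at no cost in the number
of sequential closures. At `α = γ`, adding the peak functions of the finite set `K^(γ)`, one gets a
point agreeing with `μ` on all of `C(K)`, that is, `μ` itself. This needs `γ ≠ 0`, which is where `K`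
being infinite enters.
-/


/-! ### Refining countably generated filters -/

section Refinement

variable {ι : Type*}

/-- If each property `p k` can be achieved by refining, and survives further refinement, then
all of them can be achieved at once. This is the diagonal argument for subsequences, with the
infimum of a decreasing sequence of filters in place of the diagonal sequence. -/
theorem exists_refinement_forall_nat (p : ℕ → Filter ι → Prop)
    (anti : ∀ k l l', l' ≤ l → p k l → p k l') (l : Filter ι) [l.NeBot] [l.IsCountablyGenerated]
    (step : ∀ k, ∀ l₁ ≤ l, l₁.NeBot → l₁.IsCountablyGenerated →
      ∃ l₂ ≤ l₁, l₂.NeBot ∧ l₂.IsCountablyGenerated ∧ p k l₂) :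
    ∃ l' ≤ l, l'.NeBot ∧ l'.IsCountablyGenerated ∧ ∀ k, p k l' := by
  let S := {l' : Filter ι // l' ≤ l ∧ l'.NeBot ∧ l'.IsCountablyGenerated}
  have step' : ∀ k (s : S), ∃ s' : S, s'.1 ≤ s.1 ∧ p k s'.1 := fun k s => by
    obtain ⟨l₂, h, h1, h2, h3⟩ := step k s.1 s.2.1 s.2.2.1 s.2.2.2
    exact ⟨⟨l₂, h.trans s.2.1, h1, h2⟩, h, h3⟩
  choose next hle hp using step'
  let s : ℕ → S := fun n => Nat.rec ⟨l, le_rfl, inferInstance, inferInstance⟩ next n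
  have hs : ∀ n, s (n + 1) = next n (s n) := fun n => rfl
  have hanti : Antitone fun n => (s n).1 := antitone_nat_of_succ_le fun n => by
    rw [hs]; exact hle n (s n)
  refine ⟨⨅ n, (s n).1, (iInf_le _ 0).trans (s 0).2.1, ?_, ?_, fun k => ?_⟩
  · have := fun n => (s n).2.2.1
    exact iInf_neBot_of_directed' hanti.directed_ge this
  · have := fun n => (s n).2.2.2
    infer_instance
  · refine anti k _ _ (iInf_le _ (k + 1)) ?_
    rw [hs]
    exact hp k (s k)

theorem exists_refinement_tendsto_of_isCompact {Y : Type*} [TopologicalSpace Y]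
    [FirstCountableTopology Y] {s : Set Y} (hs : IsCompact s) (g : ι → Y)
    (l : Filter ι) [l.NeBot] [l.IsCountablyGenerated] (hg : ∀ᶠ i in l, g i ∈ s) :
    ∃ l' ≤ l, l'.NeBot ∧ l'.IsCountablyGenerated ∧ ∃ c, Tendsto g l' (𝓝 c) := by
  obtain ⟨c, -, hc⟩ := hs (f := map g l) (le_principal_iff.mpr hg)
  refine ⟨l ⊓ comap g (𝓝 c), inf_le_left, ?_, inferInstance, c, ?_⟩
  · rw [neBot_inf_comap_iff_map, inf_comm]
    exact hc
  · exact tendsto_comap.mono_left inf_le_right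

variable {𝕜 : Type*} [RCLike 𝕜] {Γ : Type*}

/-- Outside a finite set of coordinates, a family that is uniformly bounded in `ℓ¹` can be made
uniformly small by refining: otherwise one could successively refine and collect arbitrarily many
coordinates at which the family stays larger than `ε`. -/
theorem exists_refinement_finset_norm_le (u : ι → Γ → 𝕜) (C : ℝ) (l : Filter ι) [l.NeBot]
    [l.IsCountablyGenerated] (hu : ∀ T : Finset Γ, ∀ᶠ i in l, ∑ x ∈ T, ‖u i x‖ ≤ C)
    {ε : ℝ} (hε : 0 < ε) :
    ∃ l' ≤ l, l'.NeBot ∧ l'.IsCountablyGenerated ∧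
      ∃ T : Finset Γ, ∀ x ∉ T, ∀ᶠ i in l', ‖u i x‖ ≤ ε := by
  classical
  by_contra! neg
  have key : ∀ m : ℕ, ∃ l' ≤ l, l'.NeBot ∧ l'.IsCountablyGenerated ∧
      ∃ T : Finset Γ, T.card = m ∧ ∀ x ∈ T, ∀ᶠ i in l', ε < ‖u i x‖ := by
    intro m
    induction m with
    | zero => exact ⟨l, le_rfl, inferInstance, inferInstance, ∅, by simp⟩
    | succ m ih =>
      obtain ⟨l', hl, h1, h2, T, hT, hTu⟩ := ih
      obtain ⟨x, hx, hxu⟩ := neg l' hl h1 h2 T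
      have hfr : ∃ᶠ i in l', ε < ‖u i x‖ := by
        simpa only [Filter.not_eventually, not_le] using hxu
      refine ⟨l' ⊓ 𝓟 {i | ε < ‖u i x‖}, inf_le_left.trans hl, ?_, inferInstance,
        insert x T, by simp [hx, hT], ?_⟩
      · exact frequently_mem_iff_neBot.mp hfr
      · intro y hy
        rcases Finset.mem_insert.mp hy with rfl | hy
        · exact (eventually_principal.mpr fun i hi => hi).filter_mono inf_le_right
        · exact (hTu y hy).filter_mono inf_le_left
  obtain ⟨m, hm⟩ := exists_nat_gt (C / ε)
  obtain ⟨l', hl, h1, h2, T, hT, hTu⟩ := key m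
  obtain ⟨i, hi, hi'⟩ := ((Finset.eventually_all T).mpr hTu |>.and ((hu T).filter_mono hl)).exists
  have : T.card • ε ≤ ∑ x ∈ T, ‖u i x‖ := Finset.card_nsmul_le_sum _ _ _ fun x hx => (hi x hx).le
  rw [hT, nsmul_eq_mul] at this
  rw [div_lt_iff₀ hε] at hm
  linarith

/-- A family that is eventually bounded in `ℓ¹(Γ)` on every finite set of coordinates converges
at every coordinate after a countably generated refinement, even though `Γ` may be uncountable. -/
theorem exists_refinement_forall_tendsto (u : ι → Γ → 𝕜) (C : ℝ) (l : Filter ι) [l.NeBot]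
    [l.IsCountablyGenerated] (hu : ∀ T : Finset Γ, ∀ᶠ i in l, ∑ x ∈ T, ‖u i x‖ ≤ C) :
    ∃ l' ≤ l, l'.NeBot ∧ l'.IsCountablyGenerated ∧ ∀ x, ∃ c, Tendsto (fun i => u i x) l' (𝓝 c) := by
  classical
  obtain ⟨l', hl, h1, h2, h⟩ := exists_refinement_forall_nat
    (fun k l' => ∃ T : Finset Γ, (∀ x ∉ T, ∀ᶠ i in l', ‖u i x‖ ≤ 1 / ((k : ℝ) + 1)) ∧
      ∀ x ∈ T, ∃ c, Tendsto (fun i => u i x) l' (𝓝 c))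
    (by
      rintro k l l' hl ⟨T, h1, h2⟩
      exact ⟨T, fun x hx => (h1 x hx).filter_mono hl,
        fun x hx => (h2 x hx).imp fun c hc => hc.mono_left hl⟩) l
    (by
      intro k l₁ hl₁ _ _
      obtain ⟨l₂, hl₂, _, _, T, hT⟩ := exists_refinement_finset_norm_le u C l₁
        (fun T => (hu T).filter_mono hl₁) (ε := 1 / ((k : ℝ) + 1)) (by positivity)
      obtain ⟨l₃, hl₃, h3, h3', c, hc⟩ := exists_refinement_tendsto_of_isCompact
        (isCompact_univ_pi fun _ : T => isCompact_closedBall (0 : 𝕜) C)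
        (fun i (x : T) => u i x) l₂ (by
          filter_upwards [(hu T).filter_mono (hl₂.trans hl₁)] with i hi x _
          rw [mem_closedBall_zero_iff]
          exact (Finset.single_le_sum (f := fun x => ‖u i x‖) (fun y _ => norm_nonneg _)
            x.2).trans hi)
      refine ⟨l₃, hl₃.trans hl₂, h3, h3', T, fun x hx => (hT x hx).filter_mono hl₃, fun x hx => ?_⟩
      exact ⟨c ⟨x, hx⟩, (tendsto_pi_nhds.mp hc) ⟨x, hx⟩⟩)
  refine ⟨l', hl, h1, h2, fun x => ?_⟩
  choose T hT hT' using h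
  by_cases hx : ∃ k, x ∈ T k
  · obtain ⟨k, hk⟩ := hx
    exact hT' k x hk
  · push Not at hx
    refine ⟨0, Metric.tendsto_nhds.mpr fun ε hε => ?_⟩
    obtain ⟨k, hk⟩ := exists_nat_one_div_lt hε
    filter_upwards [hT k x (hx k)] with i hi
    rw [dist_zero_right]
    exact hi.trans_lt hk

end Refinement

/-! ### Iterated sequential closures -/

section SeqClosure

variable {T : Type v} [TopologicalSpace T]

theorem iterSeqClosure_subset_of_isSeqClosed {F W : Set T} (hW : IsSeqClosed W) (hF : F ⊆ W)
    (α : Ordinal.{w}) : iterSeqClosure F α ⊆ W := by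
  induction α using Ordinal.limitRecOn with
  | zero => rwa [iterSeqClosure_zero]
  | add_one α ih =>
    rw [iterSeqClosure_add_one]
    rintro x ⟨a, ha, hax⟩
    exact hW (fun n => ih (ha n)) hax
  | limit α hα ih =>
    rw [iterSeqClosure_limit _ hα]
    exact iUnion₂_subset ih

theorem iterSeqClosure_subset_closure (F : Set T) (α : Ordinal.{w}) :
    iterSeqClosure F α ⊆ closure F :=
  iterSeqClosure_subset_of_isSeqClosed isClosed_closure.isSeqClosed subset_closure α

theorem seqClosure_mono {F G : Set T} (h : F ⊆ G) : seqClosure F ⊆ seqClosure G :=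
  fun _ ⟨a, ha, hax⟩ => ⟨a, fun n => h (ha n), hax⟩

theorem iterSeqClosure_mono_left {F G : Set T} (h : F ⊆ G) (α : Ordinal.{w}) :
    iterSeqClosure F α ⊆ iterSeqClosure G α := by
  induction α using Ordinal.limitRecOn with
  | zero => simpa only [iterSeqClosure_zero]
  | add_one α ih => simpa only [iterSeqClosure_add_one] using seqClosure_mono ih
  | limit α hα ih =>
    simp only [iterSeqClosure_limit _ hα]
    exact iUnion₂_mono ih

theorem iterSeqClosure_mono_right (F : Set T) : Monotone (iterSeqClosure.{v, w} F) := by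
  intro α β h
  induction β using Ordinal.limitRecOn with
  | zero => rw [nonpos_iff_eq_zero.mp h]
  | add_one β ih =>
    rcases h.eq_or_lt with rfl | h
    · exact le_rfl
    · rw [iterSeqClosure_add_one]
      exact (ih (Order.lt_add_one_iff.mp h)).trans subset_seqClosure
  | limit β hβ ih =>
    rcases h.eq_or_lt with rfl | h
    · exact le_rfl
    · rw [iterSeqClosure_limit _ hβ]
      exact subset_iUnion₂ (s := fun β _ => iterSeqClosure F β) α h

theorem sequentialSpace_of_iterSeqClosure_eq_closure {α : Ordinal.{w}}
    (h : ∀ F : Set T, iterSeqClosure F α = closure F) : SequentialSpace T where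
  isClosed_of_seq F hF := isClosed_of_closure_subset <| by
    rw [← h F]
    exact iterSeqClosure_subset_of_isSeqClosed hF le_rfl α

theorem hasSequentialOrderLE_of_iterSeqClosure_eq_closure {α : Ordinal.{w}}
    (h : ∀ F : Set T, iterSeqClosure F α = closure F) : HasSequentialOrderLE T α := by
  let s := {β : Ordinal.{w} | ∀ F : Set T, iterSeqClosure F β = closure F}
  refine ⟨sInf s, csInf_le' h, csInf_mem (s := s) ⟨α, h⟩, fun β hβ => ?_⟩
  simpa [s] using notMem_of_lt_csInf' hβ

end SeqClosure

/-! ### The dual ball -/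

section DualBall

variable {𝕜 : Type v} [RCLike 𝕜] {X : Type w} [NormedAddCommGroup X] [NormedSpace 𝕜 X]

theorem norm_dualBall_apply_le (ν : dualBall 𝕜 X) (f : X) : ‖ν.1 f‖ ≤ ‖f‖ := by
  have h : ‖WeakDual.toStrongDual ν.1‖ ≤ 1 := mem_closedBall_zero_iff.mp ν.2
  simpa using (WeakDual.toStrongDual ν.1).le_of_opNorm_le h f

theorem continuous_dualBall_apply (f : X) : Continuous fun ν : dualBall 𝕜 X => ν.1 f :=
  (WeakDual.eval_continuous f).comp continuous_subtype_val

instance compactSpace_dualBall : CompactSpace (dualBall 𝕜 X) :=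
  isCompact_iff_compactSpace.mp (WeakDual.isCompact_closedBall 0 1)

theorem dualBall_ext {ν ξ : dualBall 𝕜 X} (h : ∀ f, ν.1 f = ξ.1 f) : ν = ξ :=
  Subtype.ext (DFunLike.ext _ _ h)

theorem le_nhds_dualBall {l : Filter (dualBall 𝕜 X)} {ξ : dualBall 𝕜 X}
    (h : ∀ f, Tendsto (fun ν : dualBall 𝕜 X => ν.1 f) l (𝓝 (ξ.1 f))) : l ≤ 𝓝 ξ := by
  rw [nhds_subtype_eq_comap, ← tendsto_iff_comap]
  exact WeakBilin.tendsto_iff_forall_eval_tendsto _ ContinuousLinearMap.coe_injective |>.mpr h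

/-- The functions `f` at which a family of functionals in the dual ball converges, along `l`, to
the value of `ξ`. -/
def convergenceSubmodule {ι : Type*} (a : ι → dualBall 𝕜 X) (l : Filter ι) (ξ : dualBall 𝕜 X) :
    Submodule 𝕜 X where
  carrier := {f | Tendsto (fun i => (a i).1 f) l (𝓝 (ξ.1 f))}
  zero_mem' := by simpa using tendsto_const_nhds
  add_mem' hf hg := by simpa using hf.add hg
  smul_mem' c f hf := by simpa using hf.const_mul c

theorem mem_convergenceSubmodule {ι : Type*} {a : ι → dualBall 𝕜 X} {l : Filter ι}
    {ξ : dualBall 𝕜 X} {f : X} :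
    f ∈ convergenceSubmodule a l ξ ↔ Tendsto (fun i => (a i).1 f) l (𝓝 (ξ.1 f)) := Iff.rfl

theorem isClosed_convergenceSubmodule {ι : Type*} (a : ι → dualBall 𝕜 X) (l : Filter ι)
    (ξ : dualBall 𝕜 X) : IsClosed (convergenceSubmodule a l ξ : Set X) := by
  refine isClosed_of_closure_subset fun f hf => ?_
  refine Metric.tendsto_nhds.mpr fun ε hε => ?_
  obtain ⟨g, hg, hfg⟩ := Metric.mem_closure_iff.mp hf (ε / 3) (by positivity)
  filter_upwards [Metric.tendsto_nhds.mp hg (ε / 3) (by positivity)] with i hi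
  have key : ∀ ν : dualBall 𝕜 X, dist (ν.1 f) (ν.1 g) < ε / 3 := fun ν => by
    rw [dist_eq_norm, ← map_sub]
    exact (norm_dualBall_apply_le ν _).trans_lt (by rwa [← dist_eq_norm])
  have h1 := key (a i)
  have h2 := key ξ
  rw [dist_comm] at h2
  linarith [dist_triangle4 ((a i).1 f) ((a i).1 g) (ξ.1 g) (ξ.1 f)]

/-- Convergence at `f` to any value is convergence to the value of a given cluster point. -/
theorem tendsto_apply_of_clusterPt {l : Filter (dualBall 𝕜 X)} {ξ : dualBall 𝕜 X}
    (hξ : ClusterPt ξ l) {f : X} {c : 𝕜}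
    (h : Tendsto (fun ν : dualBall 𝕜 X => ν.1 f) l (𝓝 c)) :
    Tendsto (fun ν : dualBall 𝕜 X => ν.1 f) l (𝓝 (ξ.1 f)) := by
  have : (𝓝 ξ ⊓ l).NeBot := hξ
  have h1 := ((continuous_dualBall_apply f).tendsto ξ).mono_left (inf_le_left : 𝓝 ξ ⊓ l ≤ 𝓝 ξ)
  rwa [tendsto_nhds_unique h1 (h.mono_left inf_le_right)]

end DualBall

/-! ### Functions vanishing on a closed subset with isolated points removed -/

section ContinuousMap

variable {𝕜 : Type v} [RCLike 𝕜] {K : Type u} [TopologicalSpace K]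

/-- `e` is a family of peak functions for the points of `A \ A'`: on `A`, the function `e x` is
the indicator of `{x}`. Modulo functions vanishing on `A`, these are the unit vectors of the
space `c₀(A \ A')` of functions on `A` vanishing on `A'`. -/
structure IsPeakFamily (A A' : Set K) (e : ↥(A \ A') → C(K, 𝕜)) : Prop where
  apply_self : ∀ x, e x x = 1
  apply_ne : ∀ x : ↥(A \ A'), ∀ y ∈ A, y ≠ x → e x y = 0

variable {A A' : Set K} {e : ↥(A \ A') → C(K, 𝕜)}

theorem IsPeakFamily.sum_apply (he : IsPeakFamily A A' e) (T : Finset ↥(A \ A'))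
    (c : ↥(A \ A') → 𝕜) {y : K} (hy : y ∈ A) (hT : ∀ x ∈ T, (x : K) ≠ y) :
    (∑ x ∈ T, c x • e x) y = 0 := by
  rw [ContinuousMap.sum_apply]
  exact Finset.sum_eq_zero fun x hx => by simp [he.apply_ne x y hy (hT x hx).symm]

theorem IsPeakFamily.sum_apply_of_mem (he : IsPeakFamily A A' e) {T : Finset ↥(A \ A')}
    (c : ↥(A \ A') → 𝕜) {y : ↥(A \ A')} (hy : y ∈ T) :
    (∑ x ∈ T, c x • e x) y = c y := by
  rw [ContinuousMap.sum_apply, Finset.sum_eq_single_of_mem y hy]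
  · simp [he.apply_self]
  · intro x _ hxy
    simp [he.apply_ne x y y.2.1 fun h => hxy (Subtype.ext h.symm)]

variable [CompactSpace K]

/-- Radial truncation of a continuous function at level `ε`. -/
theorem exists_norm_le_eq_of_norm_le (g : C(K, 𝕜)) {ε : ℝ} (hε : 0 < ε) :
    ∃ h : C(K, 𝕜), ‖h‖ ≤ ε ∧ ∀ x, ‖g x‖ ≤ ε → h x = g x := by
  have hpos : ∀ x, 0 < max ε ‖g x‖ := fun x => lt_max_of_lt_left hε
  refine ⟨⟨fun x => ((ε / max ε ‖g x‖ : ℝ) : 𝕜) * g x, ?_⟩, ?_, fun x hx => ?_⟩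
  · refine (RCLike.continuous_ofReal.comp ?_).mul g.continuous
    exact continuous_const.div (continuous_const.max g.continuous.norm) fun x => (hpos x).ne'
  · refine (ContinuousMap.norm_le _ hε.le).mpr fun x => ?_
    have h1 : 0 ≤ ε / max ε ‖g x‖ := div_nonneg hε.le (hpos x).le
    rw [ContinuousMap.coe_mk, norm_mul, RCLike.norm_ofReal, abs_of_nonneg h1, div_mul_eq_mul_div,
      div_le_iff₀ (hpos x)]
    exact mul_le_mul_of_nonneg_left (le_max_right _ _) hε.le
  · simp [max_eq_left hx, hε.ne']

theorem exists_vanishing_norm_sub_le (g : C(K, 𝕜)) {A : Set K} {ε : ℝ} (hε : 0 < ε)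
    (hg : ∀ x ∈ A, ‖g x‖ ≤ ε) : ∃ h : C(K, 𝕜), (∀ x ∈ A, h x = 0) ∧ ‖g - h‖ ≤ ε := by
  obtain ⟨h, h1, h2⟩ := exists_norm_le_eq_of_norm_le g hε
  refine ⟨g - h, fun x hx => by simp [h2 x (hg x hx)], by simpa using h1⟩

/-- A continuous function that is one at `x` and zero on the rest of `A`, for `x` isolated
in `A`. -/
theorem exists_continuousMap_eq_one_of_isolated [T2Space K] {A : Set K} (hA : IsClosed A) {x : K}
    {U : Set K} (hU : IsOpen U) (hUA : U ∩ A = {x}) :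
    ∃ f : C(K, 𝕜), f x = 1 ∧ ∀ y ∈ A, y ≠ x → f y = 0 := by
  have hxU : x ∈ U := (hUA.ge rfl).1
  obtain ⟨f, h0, h1, -⟩ := exists_continuous_zero_one_of_isClosed
    (hA.inter hU.isClosed_compl) (isClosed_singleton (x := x))
    (disjoint_singleton_right.mpr fun h => h.2 hxU)
  refine ⟨⟨fun y => (f y : 𝕜), RCLike.continuous_ofReal.comp f.continuous⟩, ?_, fun y hy hyx => ?_⟩
  · simp [h1 rfl]
  · have : y ∉ U := fun h => hyx (hUA.le ⟨h, hy⟩)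
    simp [h0 ⟨hy, this⟩]

theorem exists_isPeakFamily [T2Space K] (𝕜 : Type v) [RCLike 𝕜] (hA : IsClosed A)
    (hiso : ∀ x ∈ A \ A', ∃ U, IsOpen U ∧ U ∩ A = {x}) :
    ∃ e : ↥(A \ A') → C(K, 𝕜), IsPeakFamily A A' e := by
  have : ∀ x : ↥(A \ A'), ∃ f : C(K, 𝕜), f x = 1 ∧ ∀ y ∈ A, y ≠ x → f y = 0 := fun x => by
    obtain ⟨U, hU, hUA⟩ := hiso x x.2
    exact exists_continuousMap_eq_one_of_isolated hA hU hUA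
  choose e h1 h2 using this
  exact ⟨e, h1, h2⟩

/-- A function that vanishes on `A'` is at least `ε` in norm at only finitely many points of `A`,
so it is a uniform limit of functions that vanish on `A` plus combinations of peak functions. -/
theorem IsPeakFamily.mem_of_isClosed [T2Space K] (he : IsPeakFamily A A' e) (hA : IsClosed A)
    (hiso : ∀ x ∈ A \ A', ∃ U, IsOpen U ∧ U ∩ A = {x})
    (M : Submodule 𝕜 C(K, 𝕜)) (hM : IsClosed (M : Set C(K, 𝕜)))
    (hMA : ∀ f : C(K, 𝕜), (∀ x ∈ A, f x = 0) → f ∈ M) (hMe : ∀ x, e x ∈ M)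
    {f : C(K, 𝕜)} (hf : ∀ x ∈ A', f x = 0) : f ∈ M := by
  classical
  refine hM.closure_subset (Metric.mem_closure_iff.mpr fun ε hε => ?_)
  have hε2 : 0 < ε / 2 := by positivity
  have hfin : {x : K | x ∈ A ∧ ε / 2 ≤ ‖f x‖}.Finite := by
    refine IsCompact.finite (hA.inter (isClosed_le continuous_const f.continuous.norm)).isCompact
      (isDiscrete_iff_forall_mem_exists_isOpen.mpr fun x hx => ?_)
    obtain ⟨U, hU, hUA⟩ := hiso x ⟨hx.1, fun h => by
      have : ε / 2 ≤ ‖f x‖ := hx.2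
      rw [hf x h, norm_zero] at this
      linarith⟩
    refine ⟨U, hU, Subset.antisymm (fun y hy => hUA.le ⟨hy.1, hy.2.1⟩) ?_⟩
    rintro y rfl
    exact ⟨(hUA.ge rfl).1, hx⟩
  have hfin' : {x : ↥(A \ A') | ε / 2 ≤ ‖f x‖}.Finite :=
    (hfin.preimage Subtype.val_injective.injOn).subset fun x hx => ⟨x.2.1, hx⟩
  set T := hfin'.toFinset with hT
  set s := ∑ x ∈ T, f x • e x with hs
  obtain ⟨h, hh, hhε⟩ := exists_vanishing_norm_sub_le (f - s) (A := A) hε2 (by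
    intro y hy
    by_cases hyT : ∃ x ∈ T, (x : K) = y
    · obtain ⟨x, hx, rfl⟩ := hyT
      rw [ContinuousMap.sub_apply, hs, he.sum_apply_of_mem (fun x => f x) hx, sub_self, norm_zero]
      exact hε2.le
    · push Not at hyT
      rw [ContinuousMap.sub_apply, hs, he.sum_apply T _ hy hyT, sub_zero]
      by_contra! hlt
      have hyA' : y ∉ A' := fun hyA' => by
        rw [hf y hyA', norm_zero] at hlt
        linarith
      exact hyT ⟨y, hy, hyA'⟩ (by simpa [hT] using hlt.le) rfl)
  refine ⟨s + h, M.add_mem (M.sum_mem fun x _ => M.smul_mem _ (hMe x)) (hMA h hh), ?_⟩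
  rw [dist_eq_norm, ← sub_sub]
  linarith

/-- Finitely many peak functions can be changed off `A` so that all their combinations with
coefficients in the unit disc lie in the unit ball: divide by `max 1 (∑ x ∈ T, ‖e x‖)`. -/
theorem IsPeakFamily.exists_norm_sum_smul_le (he : IsPeakFamily A A' e) (T : Finset ↥(A \ A')) :
    ∃ e' : ↥(A \ A') → C(K, 𝕜), (∀ x ∈ T, ∀ y ∈ A, (e x - e' x) y = 0) ∧
      ∀ c : ↥(A \ A') → 𝕜, (∀ x, ‖c x‖ ≤ 1) → ‖∑ x ∈ T, c x • e' x‖ ≤ 1 := by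
  classical
  let m : C(K, ℝ) := ⟨fun y => max 1 (∑ x ∈ T, ‖e x y‖), by fun_prop⟩
  have hm1 : ∀ y, 1 ≤ m y := fun y => le_max_left _ _
  have hm0 : ∀ y, 0 < m y := fun y => one_pos.trans_le (hm1 y)
  have hmA : ∀ y ∈ A, m y = 1 := fun y hy => by
    refine max_eq_left ?_
    by_cases hyT : ∃ x ∈ T, (x : K) = y
    · obtain ⟨x, hx, rfl⟩ := hyT
      rw [Finset.sum_eq_single_of_mem x hx]
      · simp [he.apply_self]
      · intro z _ hzx
        rw [he.apply_ne z x x.2.1 fun h => hzx (Subtype.ext h.symm), norm_zero]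
    · push Not at hyT
      rw [Finset.sum_eq_zero fun x hx => by rw [he.apply_ne x y hy (hyT x hx).symm, norm_zero]]
      exact zero_le_one
  refine ⟨fun x => ⟨fun y => (((m y)⁻¹ : ℝ) : 𝕜) * e x y, ?_⟩, fun x hx y hy => ?_, fun c hc => ?_⟩
  · exact (RCLike.continuous_ofReal.comp (m.continuous.inv₀ fun y => (hm0 y).ne')).mul
      (e x).continuous
  · simp [hmA y hy]
  · refine (ContinuousMap.norm_le _ zero_le_one).mpr fun y => ?_
    rw [ContinuousMap.sum_apply]
    calc ‖∑ x ∈ T, (c x • (⟨fun y => (((m y)⁻¹ : ℝ) : 𝕜) * e x y, _⟩ : C(K, 𝕜))) y‖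
        ≤ ∑ x ∈ T, (m y)⁻¹ * ‖e x y‖ := norm_sum_le_of_le _ fun x _ => by
          rw [ContinuousMap.smul_apply, smul_eq_mul, ContinuousMap.coe_mk, norm_mul, norm_mul,
            RCLike.norm_ofReal, abs_of_pos (inv_pos.mpr (hm0 y))]
          exact mul_le_of_le_one_left (by have := hm0 y; positivity) (hc x)
      _ = (m y)⁻¹ * ∑ x ∈ T, ‖e x y‖ := (Finset.mul_sum _ _ _).symm
      _ ≤ (m y)⁻¹ * m y := by
          gcongr
          · exact (inv_pos.mpr (hm0 y)).le
          · exact le_max_right _ _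
      _ = 1 := inv_mul_cancel₀ (hm0 y).ne'

theorem sum_norm_dualBall_apply_le {X : Type w} [NormedAddCommGroup X] [NormedSpace 𝕜 X]
    {Γ : Type*} (T : Finset Γ) (e : Γ → X)
    (he : ∀ c : Γ → 𝕜, (∀ x, ‖c x‖ ≤ 1) → ‖∑ x ∈ T, c x • e x‖ ≤ 1) (ν : dualBall 𝕜 X) :
    ∑ x ∈ T, ‖ν.1 (e x)‖ ≤ 1 := by
  have h := (norm_dualBall_apply_le ν _).trans
    (he (fun x => (starRingEnd 𝕜) (ν.1 (e x)) / (‖ν.1 (e x)‖ : 𝕜)) fun x => by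
      simpa using div_self_le_one ‖ν.1 (e x)‖)
  have key : ν.1 (∑ x ∈ T, ((starRingEnd 𝕜) (ν.1 (e x)) / (‖ν.1 (e x)‖ : 𝕜)) • e x) =
      ((∑ x ∈ T, ‖ν.1 (e x)‖ : ℝ) : 𝕜) := by
    rw [map_sum, RCLike.ofReal_sum]
    refine Finset.sum_congr rfl fun x _ => ?_
    rw [map_smul, smul_eq_mul, div_mul_eq_mul_div, RCLike.conj_mul, sq, mul_self_div_self]
  rw [key, RCLike.norm_ofReal] at h
  exact (le_abs_self _).trans h

/-- Two elements of the dual ball have values on the peak functions that differ by at most `2` in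
`ℓ¹`, up to the values of their difference at finitely many functions vanishing on `A`. -/
theorem IsPeakFamily.exists_sum_norm_sub_le (he : IsPeakFamily A A' e) (T : Finset ↥(A \ A')) :
    ∃ d : ↥(A \ A') → C(K, 𝕜), (∀ x ∈ T, ∀ y ∈ A, d x y = 0) ∧ ∀ ν μ : dualBall 𝕜 C(K, 𝕜),
      ∑ x ∈ T, ‖ν.1 (e x) - μ.1 (e x)‖ ≤ 2 + ∑ x ∈ T, ‖ν.1 (d x) - μ.1 (d x)‖ := by
  obtain ⟨e', h1, h2⟩ := he.exists_norm_sum_smul_le T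
  refine ⟨fun x => e x - e' x, h1, fun ν μ => ?_⟩
  have hν := sum_norm_dualBall_apply_le T e' h2 ν
  have hμ := sum_norm_dualBall_apply_le T e' h2 μ
  have : ∑ x ∈ T, ‖ν.1 (e x) - μ.1 (e x)‖ ≤ ∑ x ∈ T,
      (‖ν.1 (e' x)‖ + ‖μ.1 (e' x)‖ + ‖ν.1 (e x - e' x) - μ.1 (e x - e' x)‖) := by
    refine Finset.sum_le_sum fun x _ => ?_
    have : ν.1 (e x) - μ.1 (e x) =
        ν.1 (e' x) - μ.1 (e' x) + (ν.1 (e x - e' x) - μ.1 (e x - e' x)) := by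
      rw [map_sub, map_sub]; ring
    rw [this]
    exact (norm_add_le _ _).trans (by gcongr; exact norm_sub_le _ _)
  simp only [Finset.sum_add_distrib] at this
  linarith

end ContinuousMap

/-! ### Cantor-Bendixson derivatives -/

section CantorBendixson

variable {𝕜 : Type v} [RCLike 𝕜] {K : Type u} [TopologicalSpace K]

theorem isClosed_cbDerivative (α : Ordinal.{u}) : IsClosed (cbDerivative K α) :=
  isClosed_iteratedDerivedSet isClosed_univ α

theorem cbDerivative_antitone : Antitone (cbDerivative K) :=
  iteratedDerivedSet_antitone _

theorem exists_isOpen_inter_cbDerivative_eq_singleton (α : Ordinal.{u}) :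
    ∀ x ∈ cbDerivative K α \ cbDerivative K (α + 1), ∃ U, IsOpen U ∧ U ∩ cbDerivative K α = {x} := by
  rintro x ⟨hx, hx'⟩
  have hacc : ¬ AccPt x (𝓟 (cbDerivative K α)) := fun h => hx' <| by
    rw [cbDerivative, iteratedDerivedSet_succ, relDerivedSet_apply]
    exact ⟨h, hx⟩
  rw [accPt_iff_nhds] at hacc
  push Not at hacc
  obtain ⟨V, hV, hVx⟩ := hacc
  obtain ⟨U, hUV, hU, hxU⟩ := mem_nhds_iff.mp hV
  exact ⟨U, hU, Subset.antisymm (fun y hy => hVx y ⟨hUV hy.1, hy.2⟩)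
    (singleton_subset_iff.mpr ⟨hxU, hx⟩)⟩

variable (𝕜) in
/-- The continuous functions that vanish on `K^(α)`. -/
def vanishingOnDerivative (K : Type u) [TopologicalSpace K] (α : Ordinal.{u}) : Set C(K, 𝕜) :=
  {f | ∀ x ∈ cbDerivative K α, f x = 0}

theorem eq_zero_of_mem_vanishingOnDerivative_zero {f : C(K, 𝕜)}
    (hf : f ∈ vanishingOnDerivative 𝕜 K 0) : f = 0 :=
  ContinuousMap.ext fun x => hf x (by simp [cbDerivative])

theorem vanishingOnDerivative_mono : Monotone (vanishingOnDerivative 𝕜 K) :=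
  fun _ _ h _ hf x hx => hf x (cbDerivative_antitone h hx)

/-- At a limit ordinal `α`, the functions vanishing on some `K^(β)` with `β < α` are dense among
those vanishing on `K^(α)`. -/
theorem mem_of_mem_vanishingOnDerivative_limit [CompactSpace K] {α : Ordinal.{u}}
    (hα : Order.IsSuccLimit α) (M : Submodule 𝕜 C(K, 𝕜)) (hM : IsClosed (M : Set C(K, 𝕜)))
    (h : ∀ β < α, vanishingOnDerivative 𝕜 K β ⊆ M) : vanishingOnDerivative 𝕜 K α ⊆ M := by
  intro f hf
  refine hM.closure_subset (Metric.mem_closure_iff.mpr fun ε hε => ?_)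
  have hε2 : 0 < ε / 2 := by positivity
  have : Nonempty (Iio α) := ⟨0, hα.bot_lt⟩
  obtain ⟨β, hβ⟩ := exists_subset_nhds_of_isCompact'
    (V := fun β : Iio α => cbDerivative K β) (U := {x | ‖f x‖ < ε / 2})
    (directed_of_isDirected_le fun β β' hββ' => cbDerivative_antitone hββ')
    (fun β => (isClosed_cbDerivative _).isCompact) (fun β => isClosed_cbDerivative _)
    (fun x hx => (isOpen_lt f.continuous.norm continuous_const).mem_nhds (by
      have hx' : x ∈ cbDerivative K α := by
        rwa [cbDerivative, iteratedDerivedSet_limit hα]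
      simpa [hf x hx'] using hε))
  obtain ⟨g, hg, hfg⟩ := exists_vanishing_norm_sub_le f hε2 fun x hx => (hβ hx).le
  refine ⟨g, h β β.2 hg, ?_⟩
  rw [dist_eq_norm]
  linarith

theorem height_ne_zero [CompactSpace K] [Infinite K] (hK : IsScattered K) : height K ≠ 0 := by
  intro h
  have hd := isDiscrete_iff_discreteTopology.mpr hK.discreteTopology_cbDerivative_height
  exact infinite_univ <| by
    simpa [h, cbDerivative] using (isClosed_cbDerivative (height K)).isCompact.finite hd

theorem countable_Iio_of_lt_omega_one {α : Ordinal.{u}} (hα : α < ω₁) : Countable (Iio α) := by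
  rw [← Cardinal.mk_le_aleph0_iff, Cardinal.mk_Iio_ordinal, Cardinal.lift_le_aleph0,
    ← Order.lt_succ_iff, Cardinal.succ_aleph0]
  exact Cardinal.lt_omega_iff_card_lt.mp hα

end CantorBendixson

/-! ### Sequential compactness of the dual ball -/

section SeqCompact

variable {𝕜 : Type v} [RCLike 𝕜] {K : Type u} [TopologicalSpace K] [CompactSpace K] [T2Space K]

/-- Convergence on the functions vanishing on `A` can be improved, by refining, to convergence on
the functions vanishing on a closed set `A'` such that `A \ A'` consists of isolated points: modulo
the former functions, the deviations from the limit are bounded in `ℓ¹(A \ A')`. -/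
theorem exists_refinement_tendsto_of_isolated {A A' : Set K} (hA : IsClosed A)
    (hiso : ∀ x ∈ A \ A', ∃ U, IsOpen U ∧ U ∩ A = {x})
    (l : Filter (dualBall 𝕜 C(K, 𝕜))) [l.NeBot] [l.IsCountablyGenerated] (ξ : dualBall 𝕜 C(K, 𝕜))
    (h : ∀ f : C(K, 𝕜), (∀ x ∈ A, f x = 0) →
      Tendsto (fun ν : dualBall 𝕜 C(K, 𝕜) => ν.1 f) l (𝓝 (ξ.1 f))) :
    ∃ l' ≤ l, l'.NeBot ∧ l'.IsCountablyGenerated ∧ ∃ ξ' : dualBall 𝕜 C(K, 𝕜), ∀ f : C(K, 𝕜),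
      (∀ x ∈ A', f x = 0) → Tendsto (fun ν : dualBall 𝕜 C(K, 𝕜) => ν.1 f) l' (𝓝 (ξ'.1 f)) := by
  obtain ⟨e, he⟩ := exists_isPeakFamily 𝕜 hA hiso
  obtain ⟨l', hl, h1, h2, hc⟩ := exists_refinement_forall_tendsto
    (fun (ν : dualBall 𝕜 C(K, 𝕜)) x => ν.1 (e x) - ξ.1 (e x)) 3 l (by
      intro T
      obtain ⟨d, hd, hd'⟩ := he.exists_sum_norm_sub_le T
      have ht : Tendsto (fun ν : dualBall 𝕜 C(K, 𝕜) => ∑ x ∈ T, ‖ν.1 (d x) - ξ.1 (d x)‖) l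
          (𝓝 0) := by
        rw [← Finset.sum_const_zero (s := T)]
        exact tendsto_finsetSum _ fun x hx => tendsto_iff_norm_sub_tendsto_zero.mp (h _ (hd x hx))
      filter_upwards [ht.eventually_le_const one_pos] with ν hν
      linarith [hd' ν ξ])
  obtain ⟨ξ', hξ'⟩ := exists_clusterPt_of_compactSpace l'
  refine ⟨l', hl, h1, h2, ξ', fun f hf => ?_⟩
  refine he.mem_of_isClosed hA hiso (convergenceSubmodule id l' ξ')
    (isClosed_convergenceSubmodule _ _ _) (fun g hg => ?_) (fun x => ?_) hf
  · exact tendsto_apply_of_clusterPt hξ' ((h g hg).mono_left hl)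
  · obtain ⟨c, hc⟩ := hc x
    refine tendsto_apply_of_clusterPt hξ' (c := c + ξ.1 (e x)) ?_
    simpa using hc.add_const (ξ.1 (e x))

theorem exists_refinement_tendsto_on_vanishingOnDerivative {α : Ordinal.{u}} (hα : α < ω₁)
    (l : Filter (dualBall 𝕜 C(K, 𝕜))) [l.NeBot] [l.IsCountablyGenerated] :
    ∃ l' ≤ l, l'.NeBot ∧ l'.IsCountablyGenerated ∧ ∃ ξ : dualBall 𝕜 C(K, 𝕜),
      ∀ f ∈ vanishingOnDerivative 𝕜 K α,
        Tendsto (fun ν : dualBall 𝕜 C(K, 𝕜) => ν.1 f) l' (𝓝 (ξ.1 f)) := by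
  induction α using Ordinal.limitRecOn generalizing l with
  | zero =>
    obtain ⟨ξ, -⟩ := exists_clusterPt_of_compactSpace l
    refine ⟨l, le_rfl, inferInstance, inferInstance, ξ, fun f hf => ?_⟩
    simp [eq_zero_of_mem_vanishingOnDerivative_zero hf]
  | add_one α ih =>
    obtain ⟨l₁, hl₁, _, _, ξ, hξ⟩ := ih ((lt_add_one α).trans hα) l
    obtain ⟨l₂, hl₂, h⟩ := exists_refinement_tendsto_of_isolated (isClosed_cbDerivative α)
      (exists_isOpen_inter_cbDerivative_eq_singleton α) l₁ ξ hξ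
    exact ⟨l₂, hl₂.trans hl₁, h⟩
  | limit α hlim ih =>
    have := countable_Iio_of_lt_omega_one hα
    have : Nonempty (Iio α) := ⟨0, hlim.bot_lt⟩
    obtain ⟨b, hb⟩ := exists_surjective_nat (Iio α)
    obtain ⟨l', hl, _, _, h⟩ := exists_refinement_forall_nat
      (fun k l' => ∃ ξ : dualBall 𝕜 C(K, 𝕜), ∀ f ∈ vanishingOnDerivative 𝕜 K (b k),
        Tendsto (fun ν : dualBall 𝕜 C(K, 𝕜) => ν.1 f) l' (𝓝 (ξ.1 f)))
      (fun k l l' hl ⟨ξ, hξ⟩ => ⟨ξ, fun f hf => (hξ f hf).mono_left hl⟩) l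
      (fun k l₁ hl₁ _ _ => ih (b k) (b k).2 ((b k).2.trans hα) l₁)
    obtain ⟨ξ', hξ'⟩ := exists_clusterPt_of_compactSpace l'
    refine ⟨l', hl, inferInstance, inferInstance, ξ', mem_of_mem_vanishingOnDerivative_limit hlim
      (convergenceSubmodule id l' ξ') (isClosed_convergenceSubmodule _ _ _) fun β hβ f hf => ?_⟩
    obtain ⟨k, hk⟩ := hb ⟨β, hβ⟩
    obtain ⟨ξ, hξ⟩ := h k
    exact tendsto_apply_of_clusterPt hξ' (hξ f (by rwa [hk]))

/-- Sequential compactness of the dual ball, in terms of countably generated filters. -/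
theorem exists_refinement_le_nhds_dualBall (hK : IsScattered K) (hht : height K < ω₁)
    (l : Filter (dualBall 𝕜 C(K, 𝕜))) [l.NeBot] [l.IsCountablyGenerated] :
    ∃ l' ≤ l, l'.NeBot ∧ l'.IsCountablyGenerated ∧ ∃ ξ, l' ≤ 𝓝 ξ := by
  obtain ⟨l₁, hl₁, _, _, ξ, hξ⟩ := exists_refinement_tendsto_on_vanishingOnDerivative hht l
  have hdisc := isDiscrete_iff_forall_mem_exists_isOpen.mp
    (isDiscrete_iff_discreteTopology.mpr hK.discreteTopology_cbDerivative_height)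
  obtain ⟨l₂, hl₂, h1, h2, ξ', hξ'⟩ := exists_refinement_tendsto_of_isolated (A' := ∅)
    (isClosed_cbDerivative (height K)) (fun x hx => hdisc x hx.1) l₁ ξ hξ
  exact ⟨l₂, hl₂.trans hl₁, h1, h2, ξ', le_nhds_dualBall fun f => hξ' f (by simp)⟩

/-- If a sequence in `G` converges to `μ` at some functions, then a point of the sequential closure
of `G` agrees with `μ` at these functions. -/
theorem exists_mem_seqClosure_forall_eq (hK : IsScattered K) (hht : height K < ω₁)
    {G : Set (dualBall 𝕜 C(K, 𝕜))} (a : ℕ → dualBall 𝕜 C(K, 𝕜)) (ha : ∀ n, a n ∈ G)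
    (μ : dualBall 𝕜 C(K, 𝕜)) :
    ∃ ξ ∈ seqClosure G, ∀ f, Tendsto (fun n => (a n).1 f) atTop (𝓝 (μ.1 f)) → ξ.1 f = μ.1 f := by
  obtain ⟨l', hl, _, _, ξ, hξ⟩ := exists_refinement_le_nhds_dualBall hK hht (map a atTop)
  obtain ⟨b, hb⟩ := exists_seq_tendsto l'
  have hG : G ∈ map a atTop := mem_map.mpr (Eventually.of_forall ha)
  obtain ⟨N, hN⟩ := eventually_atTop.mp (hb.eventually (hl hG))
  refine ⟨ξ, ⟨fun n => b (n + N), fun n => hN _ (Nat.le_add_left _ _),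
    (tendsto_add_atTop_iff_nat N).mpr (hb.mono_right hξ)⟩, fun f hf => ?_⟩
  exact tendsto_nhds_unique (((continuous_dualBall_apply f).tendsto ξ).mono_left hξ)
    ((tendsto_map'_iff.mpr hf).mono_left hl)

end SeqCompact

/-! ### Reaching the closure by iterated sequential closures -/

section Reach

variable {𝕜 : Type v} [RCLike 𝕜]

/-- Every point `μ` of the closure of a set `F` in the dual ball agrees on `Z` with some point of
the `α`-th sequential closure of `F`. -/
def ReachesClosureOn (𝕜 : Type v) [RCLike 𝕜] {X : Type w} [NormedAddCommGroup X] [NormedSpace 𝕜 X] (Z : Set X)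
    (α : Ordinal.{u}) : Prop :=
  ∀ (F : Set (dualBall 𝕜 X)), ∀ μ ∈ closure F, ∃ ν ∈ iterSeqClosure F α, ∀ f ∈ Z, ν.1 f = μ.1 f

/-- The points of `S_α(F)` that agree with `μ` on `Z` accumulate at `μ`: apply the hypothesis to the
intersections of `F` with closed neighbourhoods of `μ`. -/
theorem ReachesClosureOn.mem_closure {X : Type w} [NormedAddCommGroup X] [NormedSpace 𝕜 X]
    {Z : Set X} {α : Ordinal.{u}} (h : ReachesClosureOn 𝕜 Z α) {F : Set (dualBall 𝕜 X)}
    {μ : dualBall 𝕜 X} (hμ : μ ∈ closure F) :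
    μ ∈ closure {ν | ν ∈ iterSeqClosure F α ∧ ∀ f ∈ Z, ν.1 f = μ.1 f} := by
  refine (mem_closure_iff_nhds_basis (closed_nhds_basis μ)).mpr ?_
  rintro W ⟨hW, hWc⟩
  obtain ⟨ν, hν, hνμ⟩ := h (W ∩ F) μ (mem_closure_iff_nhds.mpr fun V hV => by
    obtain ⟨x, hx, hxF⟩ := mem_closure_iff_nhds.mp hμ (V ∩ W) (inter_mem hV hW)
    exact ⟨x, hx.1, hx.2, hxF⟩)
  exact ⟨ν, ⟨iterSeqClosure_mono_left inter_subset_right α hν, hνμ⟩,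
    iterSeqClosure_subset_of_isSeqClosed hWc.isSeqClosed inter_subset_left α hν⟩

variable {K : Type u} [TopologicalSpace K] [CompactSpace K] [T2Space K]

/-- Let the points of `G` agree with `μ ∈ closure G` on the functions vanishing on `A`. Then
`μ` is the limit of a sequence in `G`, as far as functions vanishing on `A'` and finitely many
other functions are concerned. This is the argument for the Fréchet-Urysohn property of the dual
ball of `c₀(A \ A')`: choose each term close to `μ` on the coordinates where some earlier term
differs substantially from `μ`, of which there are only finitely many. -/
theorem exists_seq_tendsto_of_mem_closure {A A' : Set K} (hA : IsClosed A)
    (hiso : ∀ x ∈ A \ A', ∃ U, IsOpen U ∧ U ∩ A = {x}) {G : Set (dualBall 𝕜 C(K, 𝕜))}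
    {μ : dualBall 𝕜 C(K, 𝕜)} (hμ : μ ∈ closure G)
    (hG : ∀ ν ∈ G, ∀ f : C(K, 𝕜), (∀ x ∈ A, f x = 0) → ν.1 f = μ.1 f)
    {D : Set C(K, 𝕜)} (hD : D.Finite) :
    ∃ a : ℕ → dualBall 𝕜 C(K, 𝕜), (∀ n, a n ∈ G) ∧
      ∀ f : C(K, 𝕜), (∀ x ∈ A', f x = 0) ∨ f ∈ D →
        Tendsto (fun n => (a n).1 f) atTop (𝓝 (μ.1 f)) := by
  obtain ⟨e, he⟩ := exists_isPeakFamily 𝕜 hA hiso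
  have hsmall : ∀ f : C(K, 𝕜), ∀ ε > 0, ∀ᶠ ν in 𝓝 μ, ‖ν.1 f - μ.1 f‖ ≤ ε := fun f ε hε => by
    have := Metric.tendsto_nhds.mp ((continuous_dualBall_apply f).tendsto μ) ε hε
    filter_upwards [this] with ν hν
    rw [← dist_eq_norm]
    exact hν.le
  have hfin : ∀ ν ∈ G, ∀ ε > 0, {x | ε ≤ ‖ν.1 (e x) - μ.1 (e x)‖}.Finite := fun ν hν ε hε => by
    have hs : Summable fun x => ‖ν.1 (e x) - μ.1 (e x)‖ :=
      summable_of_sum_le (c := 2) (fun x => norm_nonneg _) fun T => by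
        obtain ⟨d, hd, hd'⟩ := he.exists_sum_norm_sub_le T
        have := hd' ν μ
        rwa [Finset.sum_eq_zero (s := T) (f := fun x => ‖ν.1 (d x) - μ.1 (d x)‖) fun x hx => by
          rw [hG ν hν _ (hd x hx), sub_self, norm_zero], add_zero] at this
    simpa only [not_lt] using
      eventually_cofinite.mp (hs.tendsto_cofinite_zero.eventually_lt_const hε)
  -- A pair `(n, ν)` records a candidate `ν` together with the precision `1 / (n + 1)`.
  obtain ⟨p, hp, hpr⟩ := exists_seq_of_forall_finset_exists
    (fun p : ℕ × dualBall 𝕜 C(K, 𝕜) => p.2 ∈ G ∧ ∀ f ∈ D, ‖p.2.1 f - μ.1 f‖ ≤ 1 / ((p.1 : ℝ) + 1))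
    (fun p q => p.1 < q.1 ∧ ∀ x, 1 / ((q.1 : ℝ) + 1) ≤ ‖p.2.1 (e x) - μ.1 (e x)‖ →
      ‖q.2.1 (e x) - μ.1 (e x)‖ ≤ 1 / ((q.1 : ℝ) + 1)) (by
      intro s hs
      obtain ⟨N, hN⟩ : ∃ N, ∀ p ∈ s, p.1 < N :=
        ⟨s.sup Prod.fst + 1, fun p hp => Nat.lt_succ_of_le (Finset.le_sup (f := Prod.fst) hp)⟩
      have hε : (0 : ℝ) < 1 / ((N : ℝ) + 1) := by positivity
      have h1 : ∀ᶠ ν in 𝓝 μ, ∀ f ∈ D, ‖ν.1 f - μ.1 f‖ ≤ 1 / ((N : ℝ) + 1) :=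
        hD.eventually_all.mpr fun f _ => hsmall f _ hε
      have h2 : ∀ᶠ ν in 𝓝 μ, ∀ p ∈ s, ∀ x ∈ {x | 1 / ((N : ℝ) + 1) ≤ ‖p.2.1 (e x) - μ.1 (e x)‖},
          ‖ν.1 (e x) - μ.1 (e x)‖ ≤ 1 / ((N : ℝ) + 1) :=
        (Finset.eventually_all s).mpr fun p hp => (hfin p.2 (hs p hp).1 _ hε).eventually_all.mpr
          fun x _ => hsmall (e x) _ hε
      obtain ⟨ν, hν, hν1, hν2⟩ := ((mem_closure_iff_frequently.mp hμ).and_eventually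
        (h1.and h2)).exists
      exact ⟨(N, ν), ⟨hν, hν1⟩, fun p hp => ⟨hN p hp, fun x hx => hν2 p hp x hx⟩⟩)
  have hmono : StrictMono fun n => (p n).1 := fun m n h => (hpr m n h).1
  have hlim : Tendsto (fun n => 1 / (((p n).1 : ℝ) + 1)) atTop (𝓝 0) :=
    tendsto_one_div_add_atTop_nhds_zero_nat.comp hmono.tendsto_atTop
  refine ⟨fun n => (p n).2, fun n => (hp n).1, ?_⟩
  rintro f (hf | hf)
  · refine he.mem_of_isClosed hA hiso (convergenceSubmodule (fun n => (p n).2) atTop μ)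
      (isClosed_convergenceSubmodule _ _ _) (fun g hg => ?_) (fun x => ?_) hf
    · refine tendsto_const_nhds.congr fun n => ?_
      exact (hG _ (hp n).1 g hg).symm
    · rw [mem_convergenceSubmodule, tendsto_iff_norm_sub_tendsto_zero]
      by_cases hx : ∀ n, (p n).2.1 (e x) = μ.1 (e x)
      · simp [hx]
      · push Not at hx
        obtain ⟨m, hm⟩ := hx
        refine squeeze_zero' (Eventually.of_forall fun n => norm_nonneg _) ?_ hlim
        filter_upwards [eventually_gt_atTop m, hlim.eventually_le_const
          (norm_pos_iff.mpr (sub_ne_zero.mpr hm))] with n hn hn'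
        exact (hpr m n hn).2 x hn'
  · rw [tendsto_iff_norm_sub_tendsto_zero]
    exact squeeze_zero (fun n => norm_nonneg _) (fun n => (hp n).2 f hf) hlim

theorem ReachesClosureOn.add_one (hK : IsScattered K) (hht : height K < ω₁) {α o : Ordinal.{u}}
    (h : ReachesClosureOn 𝕜 (vanishingOnDerivative 𝕜 K α) o) {D : Set C(K, 𝕜)} (hD : D.Finite) :
    ReachesClosureOn 𝕜 (vanishingOnDerivative 𝕜 K (α + 1) ∪ D) (o + 1) := by
  intro F μ hμ
  obtain ⟨a, ha, hlim⟩ := exists_seq_tendsto_of_mem_closure (isClosed_cbDerivative α)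
    (exists_isOpen_inter_cbDerivative_eq_singleton α) (h.mem_closure hμ) (fun ν hν => hν.2) hD
  obtain ⟨ξ, hξ, hξμ⟩ := exists_mem_seqClosure_forall_eq hK hht a (fun n => (ha n).1) μ
  rw [← iterSeqClosure_add_one] at hξ
  exact ⟨ξ, hξ, fun f hf => hξμ f (hlim f hf)⟩

theorem ReachesClosureOn.of_isSuccLimit (hK : IsScattered K) (hht : height K < ω₁)
    {α : Ordinal.{u}} (hα : Order.IsSuccLimit α) (hα₁ : α < ω₁)
    (h : ∀ β < α, ∃ o < α, ReachesClosureOn 𝕜 (vanishingOnDerivative 𝕜 K β) o)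
    {D : Set C(K, 𝕜)} (hD : D.Finite) :
    ReachesClosureOn 𝕜 (vanishingOnDerivative 𝕜 K α ∪ D) (α + 1) := by
  intro F μ hμ
  have := countable_Iio_of_lt_omega_one hα₁
  have : Nonempty (Iio α) := ⟨0, hα.bot_lt⟩
  obtain ⟨b, -, hb⟩ := exists_seq_monotone_tendsto_atTop_atTop (Iio α)
  have hex : ∀ n : ℕ, ∃ ν ∈ iterSeqClosure F α, (∀ f ∈ vanishingOnDerivative 𝕜 K (b n),
      ν.1 f = μ.1 f) ∧ ∀ f ∈ D, dist (ν.1 f) (μ.1 f) < 1 / ((n : ℝ) + 1) := fun n => by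
    obtain ⟨o, ho, hr⟩ := h (b n) (b n).2
    have hev : ∀ᶠ ν : dualBall 𝕜 C(K, 𝕜) in 𝓝 μ, ∀ f ∈ D,
        dist (ν.1 f) (μ.1 f) < 1 / ((n : ℝ) + 1) := hD.eventually_all.mpr fun f _ =>
      Metric.tendsto_nhds.mp ((continuous_dualBall_apply f).tendsto μ) _ (by positivity)
    obtain ⟨ν, hν, hνD⟩ := ((mem_closure_iff_frequently.mp (hr.mem_closure hμ)).and_eventually
      hev).exists
    exact ⟨ν, iterSeqClosure_mono_right F ho.le hν.1, hν.2, hνD⟩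
  choose a haF ha haD using hex
  obtain ⟨ξ, hξ, hξμ⟩ := exists_mem_seqClosure_forall_eq hK hht a haF μ
  rw [← iterSeqClosure_add_one] at hξ
  refine ⟨ξ, hξ, fun f hf => hξμ f ?_⟩
  rcases hf with hf | hf
  · refine mem_of_mem_vanishingOnDerivative_limit hα (convergenceSubmodule a atTop μ)
      (isClosed_convergenceSubmodule _ _ _) (fun β hβ g hg => ?_) hf
    refine tendsto_const_nhds.congr' ?_
    filter_upwards [hb.eventually_ge_atTop ⟨β, hβ⟩] with n hn
    exact (ha n g (vanishingOnDerivative_mono hn hg)).symm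
  · rw [tendsto_iff_dist_tendsto_zero]
    exact squeeze_zero (fun n => dist_nonneg) (fun n => (haD n f hf).le)
      tendsto_one_div_add_atTop_nhds_zero_nat

open Classical in
/-- The bound on the sequential order for height `α`: each successor step of the Cantor-Bendixson
process costs one sequential closure, and a limit step costs one after all the preceding ones, which
is absorbed at the next limit. -/
noncomputable def orderBound (α : Ordinal.{u}) : Ordinal.{u} :=
  if α < ω then α else α + 1

theorem orderBound_add_one (α : Ordinal.{u}) : orderBound (α + 1) = orderBound α + 1 := by
  by_cases h : α < ω
  · rw [orderBound, orderBound, if_pos h, if_pos (Ordinal.isSuccLimit_omega0.add_one_lt h)]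
  · rw [orderBound, orderBound, if_neg h, if_neg fun h' => h ((lt_add_one α).trans h')]

theorem orderBound_lt_of_isSuccLimit {α β : Ordinal.{u}} (hα : Order.IsSuccLimit α) (h : β < α) :
    orderBound β < α := by
  rw [orderBound]
  split_ifs
  · exact h
  · exact hα.add_one_lt h

theorem reachesClosureOn_vanishingOnDerivative (hK : IsScattered K) (hht : height K < ω₁)
    {α : Ordinal.{u}} (hα : α < ω₁) :
    ReachesClosureOn 𝕜 (vanishingOnDerivative 𝕜 K α) (orderBound α) ∧ (α ≠ 0 →
      ∀ D : Set C(K, 𝕜), D.Finite →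
        ReachesClosureOn 𝕜 (vanishingOnDerivative 𝕜 K α ∪ D) (orderBound α)) := by
  induction α using Ordinal.limitRecOn with
  | zero =>
    refine ⟨fun F μ hμ => ?_, fun h => (h rfl).elim⟩
    obtain ⟨ν, hν⟩ := closure_nonempty_iff.mp ⟨μ, hμ⟩
    refine ⟨ν, iterSeqClosure_mono_right F zero_le (by rwa [iterSeqClosure_zero]), ?_⟩
    intro f hf
    rw [eq_zero_of_mem_vanishingOnDerivative_zero hf, map_zero, map_zero]
  | add_one α ih =>
    have hr := fun (D : Set C(K, 𝕜)) (hD : D.Finite) =>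
      (ih ((lt_add_one α).trans hα)).1.add_one hK hht hD
    rw [orderBound_add_one]
    exact ⟨by simpa using hr ∅ finite_empty, fun _ => hr⟩
  | limit α hlim ih =>
    have hr := fun (D : Set C(K, 𝕜)) (hD : D.Finite) =>
      ReachesClosureOn.of_isSuccLimit hK hht hlim hα
        (fun β hβ => ⟨orderBound β, orderBound_lt_of_isSuccLimit hlim hβ,
          (ih β hβ (hβ.trans hα)).1⟩) hD
    rw [orderBound, if_neg (Ordinal.omega0_le_of_isSuccLimit hlim).not_gt]
    exact ⟨by simpa using hr ∅ finite_empty, fun _ => hr⟩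

/-- As `K^(γ)` is finite for `γ = height K`, adding its peak functions to the functions vanishing on
`K^(γ)` determines a functional, so the closure is reached without a further sequential closure. -/
theorem iterSeqClosure_orderBound_height [Infinite K] (hK : IsScattered K)
    (hht : height K < ω₁) (F : Set (dualBall 𝕜 C(K, 𝕜))) :
    iterSeqClosure F (orderBound (height K)) = closure F := by
  refine (iterSeqClosure_subset_closure F _).antisymm fun μ hμ => ?_
  have hd := isDiscrete_iff_discreteTopology.mpr hK.discreteTopology_cbDerivative_height
  have hA := isClosed_cbDerivative (K := K) (height K)
  have hiso : ∀ x ∈ cbDerivative K (height K) \ ∅, ∃ U, IsOpen U ∧ U ∩ cbDerivative K (height K) =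
      {x} := fun x hx => isDiscrete_iff_forall_mem_exists_isOpen.mp hd x hx.1
  obtain ⟨e, he⟩ := exists_isPeakFamily 𝕜 hA hiso
  have : Finite ↥(cbDerivative K (height K) \ ∅) := (hA.isCompact.finite hd).sdiff
  obtain ⟨ν, hν, hνμ⟩ := (reachesClosureOn_vanishingOnDerivative hK hht hht).2 (height_ne_zero hK)
    (range e) (finite_range e) F μ hμ
  have hmem : ∀ f : C(K, 𝕜), f ∈ convergenceSubmodule (fun _ : Unit => ν) ⊤ μ ↔
      ν.1 f = μ.1 f := fun f => by rw [mem_convergenceSubmodule, tendsto_const_nhds_iff]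
  rw [← dualBall_ext (ν := ν) (ξ := μ) fun f => ?_]
  · exact hν
  · rw [← hmem]
    refine he.mem_of_isClosed hA hiso _ (isClosed_convergenceSubmodule _ _ _)
      (fun g hg => (hmem g).mpr (hνμ g (Or.inl hg)))
      (fun x => (hmem _).mpr (hνμ _ (Or.inr (mem_range_self x)))) (by simp)

end Reach

theorem mainTheorem3 (𝕜 : Type v) [RCLike 𝕜] (K : Type u) [TopologicalSpace K] [T2Space K]
    [CompactSpace K] [Infinite K] (hK : IsScattered K) (hht : height K < ω₁) :
    HasWeakStarSequentialDualBall 𝕜 C(K, 𝕜) ∧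
      (height K < ω → HasSequentialOrderLE (dualBall 𝕜 C(K, 𝕜)) (height K)) ∧
      (ω ≤ height K → HasSequentialOrderLE (dualBall 𝕜 C(K, 𝕜)) (height K + 1)) := by
  have h := iterSeqClosure_orderBound_height (𝕜 := 𝕜) hK hht
  refine ⟨sequentialSpace_of_iterSeqClosure_eq_closure h, fun hlt => ?_, fun hle => ?_⟩
  · rw [orderBound, if_pos hlt] at h
    exact hasSequentialOrderLE_of_iterSeqClosure_eq_closure h
  · rw [orderBound, if_neg hle.not_gt] at h
    exact hasSequentialOrderLE_of_iterSeqClosure_eq_closure h
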